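/- A \emph{Brouwerian algebra} is an algebra $\langle L;\to,\wedge,\vee,\top\rangle$ such that $\langle L;\wedge,\vee\rangle$ is a lattice with greatest element $\top$ and $x\wedge y\le z\Leftrightarrow x\le y\to z$ for all $x,y,z\in L$. A \emph{Heyting algebra} is a Brouwerian algebra with a distinguished least element $\bot$, which belongs to all subalgebras and is preserved by homomorphisms. For an algebra $L$, let $\mathbb{V}(L)=\mathbb{HSP}(L)$ be the variety generated by $L$. For a class $\mathsf{K}$ of similar algebras, a homomorphism $h\colon L\to M$ between members of $\mathsf{K}$ is a \emph{$\mathsf{K}$-epimorphism} if $f\circ h=g\circ h$ implies $f=g$ whenever $f,g$ are homomorphisms from $M$ to a single member of $\mathsf{K}$; $\mathsf{K}$ has the \emph{ES property} if every $\mathsf{K}$-epimorphism is surjective. A subalgebra $S$ of $M\in\mathsf{K}$ is \emph{$\mathsf{K}$-epic} if any two homomorphisms from $M$ to a single member of $\mathsf{K}$ that agree on $S$ are equal. Let $A=\{\top\}\cup\{b_i,c_i,d_i : i\in\mathbb{N}\}$ (distinct elements), ordered so that $\top$ is the greatest element, $d_0$ is its only lower cover, and, for every $i$, the lower covers of $d_i$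 are the incomparable elements $b_i$ and $c_i$, each of which has $d_{i+1}$ as its only lower cover; that is, $\top>d_0>b_0,c_0>d_1>b_1,c_1>d_2>\cdots$, so $b_i\vee c_i=d_i$ and $b_i\wedge c_i=d_{i+1}$. This is the lattice reduct of a unique Brouwerian algebra $\mathbf{A}$. Let $\mathbf{A}_\bot$ be the Heyting algebra whose lattice reduct is got by adding a new least element $\bot$ to that of $\mathbf{A}$. \textbf{Theorem.} The Brouwerian algebra $\mathbf{A}$ is denumerable and subdirectly irreducible (i.e., it has a least non-identity congruence), and the following hold. (1) The set $B=\{b_i : i\in\mathbb{N}\}\cup\{\top\}$ is the universe of a proper, $\mathbb{V}(\mathbf{A})$-epic subalgebra of $\mathbf{A}$. In particular, the ES property fails in $\mathbb{V}(\mathbf{A})$. (2) The set $B\cup\{\bot\}$ is the universe of a proper, $\mathbb{V}(\mathbf{A}_\bot)$-epic subalgebra of $\mathbf{A}_\bot$. In particular, the ES property fails in $\mathbb{V}(\mathbf{A}_\bot)$. -/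

import Mathlib

universe u v w

/-! ### Brouwerian algebras

A Brouwerian algebra is a lattice with greatest element and a binary operation `⇨` such that
`a ≤ b ⇨ c ↔ a ⊓ b ≤ c`; this is Mathlib's `GeneralizedHeytingAlgebra`.  A Heyting algebra is a
Brouwerian algebra with a distinguished least element; this is Mathlib's `HeytingAlgebra`, and
its homomorphisms are Mathlib's `HeytingHom`. -/

/-- Homomorphisms of Brouwerian algebras: maps preserving `⊓`, `⊔`, `⊤` and `⇨`. -/
structure BrouwerianHom (A : Type u) (B : Type v) [GeneralizedHeytingAlgebra A]
    [GeneralizedHeytingAlgebra B] extends LatticeHom A B where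
  map_top' : toFun ⊤ = ⊤
  map_himp' : ∀ a b, toFun (a ⇨ b) = toFun a ⇨ toFun b

namespace BrouwerianHom

instance instFunLike {A : Type u} {B : Type v} [GeneralizedHeytingAlgebra A]
    [GeneralizedHeytingAlgebra B] : FunLike (BrouwerianHom A B) A B where
  coe f := f.toFun
  coe_injective f g h := by
    obtain ⟨⟨⟨_, _⟩, _⟩, _, _⟩ := f
    obtain ⟨⟨⟨_, _⟩, _⟩, _, _⟩ := g
    congr

/-- Composition of homomorphisms of Brouwerian algebras. -/
def comp {A : Type u} {B : Type v} {C : Type w} [GeneralizedHeytingAlgebra A]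
    [GeneralizedHeytingAlgebra B] [GeneralizedHeytingAlgebra C]
    (g : BrouwerianHom B C) (f : BrouwerianHom A B) : BrouwerianHom A C where
  toLatticeHom := g.toLatticeHom.comp f.toLatticeHom
  map_top' := (congrArg g.toFun f.map_top').trans g.map_top'
  map_himp' a b := (congrArg g.toFun (f.map_himp' a b)).trans (g.map_himp' _ _)

end BrouwerianHom

/-- Subalgebras of a Brouwerian algebra: subsets closed under `⊓`, `⊔`, `⊤` and `⇨`. -/
structure BrouwerianSubalgebra (A : Type u) [GeneralizedHeytingAlgebra A]
    extends Sublattice A where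
  top_mem' : ⊤ ∈ carrier
  himp_mem' : ∀ {a b : A}, a ∈ carrier → b ∈ carrier → a ⇨ b ∈ carrier

instance BrouwerianSubalgebra.instSetLike {A : Type u} [GeneralizedHeytingAlgebra A] :
    SetLike (BrouwerianSubalgebra A) A where
  coe S := S.carrier
  coe_injective S T h := by
    obtain ⟨⟨_, _, _⟩, _, _⟩ := S
    obtain ⟨⟨_, _, _⟩, _, _⟩ := T
    congr

/-- A subalgebra is a Brouwerian algebra under the restricted operations. -/
instance BrouwerianSubalgebra.instGeneralizedHeytingAlgebra {A : Type u}
    [GeneralizedHeytingAlgebra A] (S : BrouwerianSubalgebra A) :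
    GeneralizedHeytingAlgebra S where
  __ := (inferInstanceAs (Lattice S.toSublattice) : Lattice S)
  top := ⟨⊤, S.top_mem'⟩
  le_top a := (le_top : (a : A) ≤ ⊤)
  himp a b := ⟨(a : A) ⇨ (b : A), S.himp_mem' a.2 b.2⟩
  le_himp_iff a b c := le_himp_iff (a := (a : A)) (b := (b : A)) (c := (c : A))

/-- Subalgebras of a Heyting algebra: subsets closed under `⊓`, `⊔`, `⊤`, `⊥` and `⇨`. -/
structure HeytingSubalgebra (A : Type u) [HeytingAlgebra A]
    extends BrouwerianSubalgebra A where
  bot_mem' : ⊥ ∈ carrier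

instance HeytingSubalgebra.instSetLike {A : Type u} [HeytingAlgebra A] :
    SetLike (HeytingSubalgebra A) A where
  coe S := S.carrier
  coe_injective S T h := by
    obtain ⟨⟨⟨_, _, _⟩, _, _⟩, _⟩ := S
    obtain ⟨⟨⟨_, _, _⟩, _, _⟩, _⟩ := T
    congr

/-- A subalgebra is a Heyting algebra under the restricted operations. -/
instance HeytingSubalgebra.instHeytingAlgebra {A : Type u}
    [HeytingAlgebra A] (S : HeytingSubalgebra A) : HeytingAlgebra S where
  __ := (inferInstanceAs (GeneralizedHeytingAlgebra S.toBrouwerianSubalgebra) :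
    GeneralizedHeytingAlgebra S)
  bot := ⟨⊥, S.bot_mem'⟩
  bot_le a := (bot_le : (⊥ : A) ≤ a)
  compl a := ⟨(a : A) ⇨ ⊥, S.himp_mem' a.2 S.bot_mem'⟩
  himp_bot _ := rfl

/-! ### Classes of algebras, generated varieties, epimorphisms -/

/-- Classes of Brouwerian algebras. -/
abbrev BrouwerianClass : Type (u + 1) :=
  ∀ X : Type u, [GeneralizedHeytingAlgebra X] → Prop

/-- Classes of Heyting algebras. -/
abbrev HeytingClass : Type (u + 1) :=
  ∀ X : Type u, [HeytingAlgebra X] → Prop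

/-- The variety `HSP(A)` generated by the Brouwerian algebra `A`: all homomorphic images of
subalgebras of direct powers of `A`. -/
def brouwerianVariety (A : Type u) [GeneralizedHeytingAlgebra A] : BrouwerianClass.{u} :=
  fun C _ => ∃ (I : Type u) (S : BrouwerianSubalgebra (I → A))
    (q : BrouwerianHom S C), Function.Surjective q

/-- The variety `HSP(A)` generated by the Heyting algebra `A`: all homomorphic images of
subalgebras of direct powers of `A`. -/
def heytingVariety (A : Type u) [HeytingAlgebra A] : HeytingClass.{u} :=
  fun C _ => ∃ (I : Type u) (S : HeytingSubalgebra (I → A))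
    (q : HeytingHom S C), Function.Surjective q

/-- `h` is a `K`-epimorphism (`A` and `B` are meant to belong to `K`). -/
def IsBrouwerianEpi (K : BrouwerianClass.{u}) {A B : Type u} [GeneralizedHeytingAlgebra A]
    [GeneralizedHeytingAlgebra B] (h : BrouwerianHom A B) : Prop :=
  ∀ (C : Type u) [GeneralizedHeytingAlgebra C], K C →
    ∀ f g : BrouwerianHom B C, f.comp h = g.comp h → f = g

/-- The ES property of `K`: every `K`-epimorphism between members of `K` is surjective. -/
def BrouwerianES (K : BrouwerianClass.{u}) : Prop :=
  ∀ (A B : Type u) [GeneralizedHeytingAlgebra A] [GeneralizedHeytingAlgebra B], K A → K B →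
    ∀ h : BrouwerianHom A B, IsBrouwerianEpi K h → Function.Surjective h

/-- The subalgebra `S` of `B` is `K`-epic: homomorphisms from `B` into members of `K` are
determined by their restrictions to `S`. -/
def BrouwerianSubalgebra.IsEpic (K : BrouwerianClass.{u}) {B : Type u}
    [GeneralizedHeytingAlgebra B] (S : BrouwerianSubalgebra B) : Prop :=
  ∀ (C : Type u) [GeneralizedHeytingAlgebra C], K C →
    ∀ f g : BrouwerianHom B C, (∀ x ∈ S.carrier, f x = g x) → f = g

/-- `h` is a `K`-epimorphism (`A` and `B` are meant to belong to `K`). -/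
def IsHeytingEpi (K : HeytingClass.{u}) {A B : Type u} [HeytingAlgebra A]
    [HeytingAlgebra B] (h : HeytingHom A B) : Prop :=
  ∀ (C : Type u) [HeytingAlgebra C], K C →
    ∀ f g : HeytingHom B C, f.comp h = g.comp h → f = g

/-- The ES property of `K`: every `K`-epimorphism between members of `K` is surjective. -/
def HeytingES (K : HeytingClass.{u}) : Prop :=
  ∀ (A B : Type u) [HeytingAlgebra A] [HeytingAlgebra B], K A → K B →
    ∀ h : HeytingHom A B, IsHeytingEpi K h → Function.Surjective h

/-- The subalgebra `S` of `B` is `K`-epic: homomorphisms from `B` into members of `K` are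
determined by their restrictions to `S`. -/
def HeytingSubalgebra.IsEpic (K : HeytingClass.{u}) {B : Type u}
    [HeytingAlgebra B] (S : HeytingSubalgebra B) : Prop :=
  ∀ (C : Type u) [HeytingAlgebra C], K C →
    ∀ f g : HeytingHom B C, (∀ x ∈ S.carrier, f x = g x) → f = g

/-- Congruences of a Brouwerian algebra (compatibility with the constant `⊤` is automatic). -/
structure IsBrouwerianCongruence {A : Type u} [GeneralizedHeytingAlgebra A]
    (θ : Setoid A) : Prop where
  inf : ∀ {a b c d : A}, θ a b → θ c d → θ (a ⊓ c) (b ⊓ d)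
  sup : ∀ {a b c d : A}, θ a b → θ c d → θ (a ⊔ c) (b ⊔ d)
  himp : ∀ {a b c d : A}, θ a b → θ c d → θ (a ⇨ c) (b ⇨ d)

/-- `A` is subdirectly irreducible: it has a least non-identity congruence. -/
def IsSubdirectlyIrreducible (A : Type u) [GeneralizedHeytingAlgebra A] : Prop :=
  ∃ θ : Setoid A, IsBrouwerianCongruence θ ∧ θ ≠ ⊥ ∧
    ∀ φ : Setoid A, IsBrouwerianCongruence φ → φ ≠ ⊥ → θ ≤ φ

/-! ### Adding a new least element -/

/-- The Heyting algebra `A_⊥` obtained from a Brouwerian algebra `A` by adding a new least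
element to its lattice reduct. -/
instance WithBot.instHeytingAlgebraOfBrouwerian {A : Type u} [GeneralizedHeytingAlgebra A] :
    HeytingAlgebra (WithBot A) where
  __ := (inferInstance : Lattice (WithBot A))
  __ := (inferInstance : BoundedOrder (WithBot A))
  himp x y := WithBot.recBotCoe ⊤
    (fun a => WithBot.recBotCoe ⊥ (fun b => ((a ⇨ b : A) : WithBot A)) y) x
  compl x := WithBot.recBotCoe ⊤ (fun _ => ⊥) x
  le_himp_iff x y z := by
    cases y with
    | bot => simp
    | coe b =>
      cases z with
      | bot => cases x <;> simp [← WithBot.coe_inf]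
      | coe c =>
        cases x with
        | bot => simp
        | coe a => simp [← WithBot.coe_inf]
  himp_bot x := by cases x <;> rfl

/-! ### The ladder

The lattice consists of `⊤` and the elements `b i`, `c i`, `d i` (`i ∈ ℕ`), where `d 0` is the
unique lower cover of `⊤`, the lower covers of `d i` are the incomparable elements `b i` and
`c i`, and `d (i + 1)` is the unique lower cover of `b i` and of `c i`.  There is no least
element. -/

/-- The universe of the ladder. -/
inductive Ladder : Type u
  | top : Ladder
  | d (i : ℕ) : Ladder
  | b (i : ℕ) : Ladder
  | c (i : ℕ) : Ladder

namespace Ladder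

/-- The distance of an element from the greatest element in the Hasse diagram. -/
def depth : Ladder.{u} → ℕ
  | top => 0
  | d i => 2 * i + 1
  | b i => 2 * i + 2
  | c i => 2 * i + 2

/-- `b i ⊔ c i = d i = c i ⊔ b i`; any other two elements are comparable. -/
def join : Ladder.{u} → Ladder.{u} → Ladder.{u}
  | b i, c j => if i = j then d i else if i < j then b i else c j
  | c i, b j => if i = j then d i else if i < j then c i else b j
  | x, y => if x.depth ≤ y.depth then x else y

/-- `b i ⊓ c i = d (i + 1) = c i ⊓ b i`; any other two elements are comparable. -/
def meet : Ladder.{u} → Ladder.{u} → Ladder.{u}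
  | b i, c j => if i = j then d (i + 1) else if i < j then c j else b i
  | c i, b j => if i = j then d (i + 1) else if i < j then b j else c i
  | x, y => if x.depth ≤ y.depth then y else x

/-- `x` lies below `y` if they are equal or `x` is strictly further from the top. -/
instance instPartialOrder : PartialOrder Ladder.{u} where
  le x y := x = y ∨ y.depth < x.depth
  le_refl _ := Or.inl rfl
  le_trans x y z := by
    rintro (rfl | h) (rfl | h')
    · exact Or.inl rfl
    · exact Or.inr h'
    · exact Or.inr h
    · exact Or.inr (h'.trans h)
  le_antisymm x y := by
    rintro (rfl | h) (h' | h')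
    · rfl
    · rfl
    · exact h'.symm
    · omega

theorem le_def {x y : Ladder.{u}} : x ≤ y ↔ x = y ∨ y.depth < x.depth := Iff.rfl

instance instLattice : Lattice Ladder.{u} where
  sup := join
  inf := meet
  le_sup_left x y := by
    cases x <;> cases y <;> simp only [join, le_def, depth] <;> grind [depth]
  le_sup_right x y := by
    cases x <;> cases y <;> simp only [join, le_def, depth] <;> grind [depth]
  sup_le x y z := by
    cases x <;> cases y <;> cases z <;> simp only [join, le_def, depth] <;> grind [depth]
  inf_le_left x y := by
    cases x <;> cases y <;> simp only [meet, le_def, depth] <;> grind [depth]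
  inf_le_right x y := by
    cases x <;> cases y <;> simp only [meet, le_def, depth] <;> grind [depth]
  le_inf x y z := by
    cases x <;> cases y <;> cases z <;> simp only [meet, le_def, depth] <;> grind [depth]

/-- The implication: `x ⇨ y = ⊤` if `x ≤ y`; `b i ⇨ d (i + 1) = c i` and
`c i ⇨ d (i + 1) = b i`; and `x ⇨ y = y` in all other cases. -/
def imp : Ladder.{u} → Ladder.{u} → Ladder.{u}
  | top, y => y
  | _, top => top
  | d i, d j => if j ≤ i then top else d j
  | d i, b j => if j < i then top else b j
  | d i, c j => if j < i then top else c j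
  | b i, d j => if j ≤ i then top else if j = i + 1 then c i else d j
  | b i, b j => if j ≤ i then top else b j
  | b i, c j => if j < i then top else c j
  | c i, d j => if j ≤ i then top else if j = i + 1 then b i else d j
  | c i, b j => if j < i then top else b j
  | c i, c j => if j ≤ i then top else c j

/-- The Brouwerian algebra whose lattice reduct is the ladder. -/
instance instGeneralizedHeytingAlgebra :
    GeneralizedHeytingAlgebra Ladder.{u} where
  top := top
  le_top x := by cases x <;> simp [le_def, depth]
  himp := imp
  le_himp_iff x y z := by
    change x ≤ imp y z ↔ meet x y ≤ z
    cases x <;> cases y <;> cases z <;> simp only [imp, meet] <;> split_ifs <;>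
      simp only [le_def, depth, reduceCtorEq, d.injEq, b.injEq, c.injEq, true_or, false_or] at * <;>
      first | omega | grind

/-- The subalgebra of the ladder with universe `{b i | i ∈ ℕ} ∪ {⊤}`. -/
def B : BrouwerianSubalgebra Ladder.{u} where
  carrier := Set.range b ∪ {⊤}
  supClosed' := by
    rintro _ (⟨i, rfl⟩ | rfl) _ (⟨j, rfl⟩ | rfl)
    · rcases le_total i j with h | h
      · exact Or.inl ⟨i, by change _ = join _ _; grind [join, depth]⟩
      · exact Or.inl ⟨j, by change _ = join _ _; grind [join, depth]⟩
    all_goals simp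
  infClosed' := by
    rintro _ (⟨i, rfl⟩ | rfl) _ (⟨j, rfl⟩ | rfl)
    · rcases le_total i j with h | h
      · exact Or.inl ⟨j, by change _ = meet _ _; grind [meet, depth]⟩
      · exact Or.inl ⟨i, by change _ = meet _ _; grind [meet, depth]⟩
    all_goals simp
  top_mem' := Or.inr rfl
  himp_mem' := by
    rintro _ _ (⟨i, rfl⟩ | rfl) (⟨j, rfl⟩ | rfl)
    · by_cases h : j ≤ i
      · exact Or.inr (by change imp _ _ = top; simp [imp, h])
      · exact Or.inl ⟨j, by change _ = imp _ _; simp [imp, h]⟩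
    all_goals simp

/-- The subalgebra of `Ladder_⊥` with universe `{b i | i ∈ ℕ} ∪ {⊤} ∪ {⊥}`. -/
def Bbot : HeytingSubalgebra (WithBot Ladder.{u}) where
  carrier := insert ⊥ ((fun x : Ladder.{u} => (x : WithBot Ladder.{u})) '' B.carrier)
  supClosed' := by
    rintro _ (rfl | ⟨x, hx, rfl⟩) _ (rfl | ⟨y, hy, rfl⟩)
    · exact Or.inl (by simp)
    · exact Or.inr ⟨y, hy, by simp⟩
    · exact Or.inr ⟨x, hx, by simp⟩
    · exact Or.inr ⟨x ⊔ y, B.supClosed' hx hy, by simp⟩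
  infClosed' := by
    rintro _ (rfl | ⟨x, hx, rfl⟩) _ (rfl | ⟨y, hy, rfl⟩)
    · exact Or.inl (by simp)
    · exact Or.inl (by simp)
    · exact Or.inl (by simp)
    · exact Or.inr ⟨x ⊓ y, B.infClosed' hx hy, by simp⟩
  top_mem' := Or.inr ⟨⊤, B.top_mem', rfl⟩
  bot_mem' := Or.inl rfl
  himp_mem' := by
    rintro _ _ (rfl | ⟨x, hx, rfl⟩) (rfl | ⟨y, hy, rfl⟩)
    · exact Or.inr ⟨⊤, B.top_mem', rfl⟩
    · exact Or.inr ⟨⊤, B.top_mem', rfl⟩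
    · exact Or.inl rfl
    · exact Or.inr ⟨x ⇨ y, B.himp_mem' hx hy, rfl⟩

end Ladder

/-! In the ladder an element is incomparable with at most one other element. Written as the identity
`UniqueIncomparable`, this survives powers, subalgebras and homomorphic images, so it holds
throughout the generated variety. A new least element is comparable with everything, so the identity
also holds for the Heyting version.

Let `f` and `g` agree on every `b i`. In the target, `f (c (n + 1))` and `g (c (n + 1))` play the
same role relative to the common value at `b (n + 1)`, so the identity makes them equal up to
elements lying below the common value at `b n`. Since `d n` is obtained from `c (n + 1)` by joins
and implications with `b n` and `b (n + 1)`, and lies above `b n`, that error vanishes at `d n`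
(`hom_d_le`). Then `c n = b n ⇨ d (n + 1)` settles the rest (`hom_eq`). No induction is possible or
needed: each `d n` is determined from the level just below it.

Subdirect irreducibility comes from `d 0` being the greatest element below `⊤`. -/

/-! ### Homomorphisms and inclusions -/

namespace BrouwerianHom

variable {A : Type u} {B : Type v} [GeneralizedHeytingAlgebra A] [GeneralizedHeytingAlgebra B]

theorem ext {f g : BrouwerianHom A B} (h : ∀ x, f x = g x) : f = g :=
  DFunLike.ext f g h

theorem apply_sup (f : BrouwerianHom A B) (x y : A) : f (x ⊔ y) = f x ⊔ f y :=
  f.toLatticeHom.map_sup' x y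

theorem apply_inf (f : BrouwerianHom A B) (x y : A) : f (x ⊓ y) = f x ⊓ f y :=
  f.toLatticeHom.map_inf' x y

theorem apply_top (f : BrouwerianHom A B) : f ⊤ = ⊤ :=
  f.map_top'

theorem apply_himp (f : BrouwerianHom A B) (x y : A) : f (x ⇨ y) = f x ⇨ f y :=
  f.map_himp' x y

theorem monotone (f : BrouwerianHom A B) : Monotone f := fun x y h => by
  rw [← sup_eq_right, ← f.apply_sup, sup_eq_right.2 h]

end BrouwerianHom

/-- The inclusion of a subalgebra. -/
def BrouwerianSubalgebra.subtype {A : Type u} [GeneralizedHeytingAlgebra A]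
    (S : BrouwerianSubalgebra A) : BrouwerianHom S A where
  toFun := Subtype.val
  map_sup' _ _ := rfl
  map_inf' _ _ := rfl
  map_top' := rfl
  map_himp' _ _ := rfl

/-- The inclusion of a subalgebra. -/
def HeytingSubalgebra.subtype {A : Type u} [HeytingAlgebra A]
    (S : HeytingSubalgebra A) : HeytingHom S A where
  toFun := Subtype.val
  map_sup' _ _ := rfl
  map_inf' _ _ := rfl
  map_bot' := rfl
  map_himp' _ _ := rfl

/-- A Heyting homomorphism, regarded as a homomorphism of Brouwerian algebras. -/
def HeytingHom.toBrouwerianHom {A : Type u} {B : Type v} [HeytingAlgebra A] [HeytingAlgebra B]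
    (f : HeytingHom A B) : BrouwerianHom A B where
  toLatticeHom := f.toLatticeHom
  map_top' := map_top f
  map_himp' := map_himp f

/-- The embedding of a Brouwerian algebra into its extension by a new least element. -/
def WithBot.brouwerianCoe (A : Type u) [GeneralizedHeytingAlgebra A] :
    BrouwerianHom A (WithBot A) where
  toFun := WithBot.some
  map_sup' _ _ := rfl
  map_inf' _ _ := rfl
  map_top' := rfl
  map_himp' _ _ := rfl

/-! ### Epic subalgebras and the ES property -/

theorem brouwerianVariety_subalgebra {A : Type u} [GeneralizedHeytingAlgebra A]
    (S : BrouwerianSubalgebra A) : brouwerianVariety A S := by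
  -- The power with a one-point index set is a copy of `A`, and evaluation at that point is the
  -- required surjection.
  refine ⟨PUnit,
    { carrier := {x | x ⟨⟩ ∈ S.carrier}
      supClosed' := fun x hx y hy => S.supClosed' hx hy
      infClosed' := fun x hx y hy => S.infClosed' hx hy
      top_mem' := S.top_mem'
      himp_mem' := fun hx hy => S.himp_mem' hx hy },
    { toFun := fun x => ⟨x.1 ⟨⟩, x.2⟩
      map_sup' := fun _ _ => rfl
      map_inf' := fun _ _ => rfl
      map_top' := rfl
      map_himp' := fun _ _ => rfl }, fun y => ⟨⟨fun _ => y.1, y.2⟩, rfl⟩⟩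

theorem brouwerianVariety_self (A : Type u) [GeneralizedHeytingAlgebra A] :
    brouwerianVariety A A := by
  refine ⟨PUnit,
    { carrier := Set.univ
      supClosed' := fun _ _ _ _ => trivial
      infClosed' := fun _ _ _ _ => trivial
      top_mem' := trivial
      himp_mem' := fun _ _ => trivial },
    { toFun := fun x => x.1 ⟨⟩
      map_sup' := fun _ _ => rfl
      map_inf' := fun _ _ => rfl
      map_top' := rfl
      map_himp' := fun _ _ => rfl }, fun y => ⟨⟨fun _ => y, trivial⟩, rfl⟩⟩

theorem heytingVariety_subalgebra {A : Type u} [HeytingAlgebra A]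
    (S : HeytingSubalgebra A) : heytingVariety A S := by
  refine ⟨PUnit,
    { carrier := {x | x ⟨⟩ ∈ S.carrier}
      supClosed' := fun x hx y hy => S.supClosed' hx hy
      infClosed' := fun x hx y hy => S.infClosed' hx hy
      top_mem' := S.top_mem'
      bot_mem' := S.bot_mem'
      himp_mem' := fun hx hy => S.himp_mem' hx hy },
    { toFun := fun x => ⟨x.1 ⟨⟩, x.2⟩
      map_sup' := fun _ _ => rfl
      map_inf' := fun _ _ => rfl
      map_bot' := rfl
      map_himp' := fun _ _ => rfl }, fun y => ⟨⟨fun _ => y.1, y.2⟩, rfl⟩⟩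

theorem heytingVariety_self (A : Type u) [HeytingAlgebra A] : heytingVariety A A := by
  refine ⟨PUnit,
    { carrier := Set.univ
      supClosed' := fun _ _ _ _ => trivial
      infClosed' := fun _ _ _ _ => trivial
      top_mem' := trivial
      bot_mem' := trivial
      himp_mem' := fun _ _ => trivial },
    { toFun := fun x => x.1 ⟨⟩
      map_sup' := fun _ _ => rfl
      map_inf' := fun _ _ => rfl
      map_bot' := rfl
      map_himp' := fun _ _ => rfl }, fun y => ⟨⟨fun _ => y, trivial⟩, rfl⟩⟩

/-- A proper epic subalgebra refutes the ES property. -/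
theorem not_brouwerianES_of_isEpic {A : Type u} [GeneralizedHeytingAlgebra A]
    (S : BrouwerianSubalgebra A) (hS : S.carrier ≠ Set.univ)
    (h : S.IsEpic (brouwerianVariety A)) : ¬ BrouwerianES (brouwerianVariety A) := fun hES => by
  refine hS (Set.eq_univ_of_forall fun x => ?_)
  obtain ⟨y, rfl⟩ := hES S A (brouwerianVariety_subalgebra S) (brouwerianVariety_self A) S.subtype
    (fun C _ hC f g hfg => h C hC f g fun x hx =>
      DFunLike.congr_fun hfg (⟨x, hx⟩ : S)) x
  exact y.2

/-- A proper epic subalgebra refutes the ES property. -/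
theorem not_heytingES_of_isEpic {A : Type u} [HeytingAlgebra A]
    (S : HeytingSubalgebra A) (hS : S.carrier ≠ Set.univ)
    (h : S.IsEpic (heytingVariety A)) : ¬ HeytingES (heytingVariety A) := fun hES => by
  refine hS (Set.eq_univ_of_forall fun x => ?_)
  obtain ⟨y, rfl⟩ := hES S A (heytingVariety_subalgebra S) (heytingVariety_self A) S.subtype
    (fun C _ hC f g hfg => h C hC f g fun x hx =>
      DFunLike.congr_fun hfg (⟨x, hx⟩ : S)) x
  exact y.2

/-! ### An identity inherited by the generated variety -/

/-- The equational form of the condition that no element is incomparable with two distinct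
elements. -/
def UniqueIncomparable (A : Type u) [GeneralizedHeytingAlgebra A] : Prop :=
  ∀ x y z : A, (x ⇨ y) ⊔ (y ⇨ x) ⊔ (x ⇨ z) ⊔ (z ⇨ x) ⊔ (y ⇨ z) ⊓ (z ⇨ y) = ⊤

namespace UniqueIncomparable

/-- Each of the five alternatives makes one of the five joinands equal to `⊤`. -/
theorem of_forall {A : Type u} [GeneralizedHeytingAlgebra A]
    (h : ∀ x y z : A, x ≤ y ∨ y ≤ x ∨ x ≤ z ∨ z ≤ x ∨ y = z) : UniqueIncomparable A := by
  intro x y z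
  rcases h x y z with h | h | h | h | rfl
  · simp [himp_eq_top_iff.2 h]
  · simp [himp_eq_top_iff.2 h]
  · simp [himp_eq_top_iff.2 h]
  · simp [himp_eq_top_iff.2 h]
  · simp

theorem pi {A : Type u} [GeneralizedHeytingAlgebra A] (h : UniqueIncomparable A) (I : Type v) :
    UniqueIncomparable (I → A) :=
  fun x y z => funext fun i => h (x i) (y i) (z i)

theorem subalgebra {A : Type u} [GeneralizedHeytingAlgebra A] (h : UniqueIncomparable A)
    (S : BrouwerianSubalgebra A) : UniqueIncomparable S :=
  fun x y z => Subtype.ext (h x.1 y.1 z.1)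

theorem of_surjective {A : Type u} {B : Type v} [GeneralizedHeytingAlgebra A]
    [GeneralizedHeytingAlgebra B] (h : UniqueIncomparable A) (q : BrouwerianHom A B)
    (hq : Function.Surjective q) : UniqueIncomparable B := by
  intro x y z
  obtain ⟨x, rfl⟩ := hq x
  obtain ⟨y, rfl⟩ := hq y
  obtain ⟨z, rfl⟩ := hq z
  simp only [← q.apply_himp, ← q.apply_sup, ← q.apply_inf, h x y z, q.apply_top]

theorem of_brouwerianVariety {A C : Type u} [GeneralizedHeytingAlgebra A]
    [GeneralizedHeytingAlgebra C] (h : UniqueIncomparable A) (hC : brouwerianVariety A C) :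
    UniqueIncomparable C := by
  obtain ⟨I, S, q, hq⟩ := hC
  exact ((h.pi I).subalgebra S).of_surjective q hq

theorem of_heytingVariety {A C : Type u} [HeytingAlgebra A]
    [HeytingAlgebra C] (h : UniqueIncomparable A) (hC : heytingVariety A C) :
    UniqueIncomparable C := by
  obtain ⟨I, S, q, hq⟩ := hC
  exact UniqueIncomparable.of_surjective (A := S)
    ((h.pi I).subalgebra S.toBrouwerianSubalgebra) q.toBrouwerianHom hq

end UniqueIncomparable

/-! ### The identity and small computations in the ladder -/

namespace Ladder

/-- Incomparable elements are distinct and have equal depth, and each depth is attained at most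
twice, by `b i` and `c i`. -/
theorem incomparable_unique (x y z : Ladder.{u}) :
    x ≤ y ∨ y ≤ x ∨ x ≤ z ∨ z ≤ x ∨ y = z := by
  cases x <;> cases y <;> cases z <;> simp only [le_def, depth, reduceCtorEq, d.injEq, b.injEq,
    c.injEq, true_or] <;> omega

theorem uniqueIncomparable : UniqueIncomparable Ladder.{u} :=
  .of_forall incomparable_unique

theorem uniqueIncomparable_withBot : UniqueIncomparable (WithBot Ladder.{u}) := by
  refine .of_forall fun x y z => ?_
  cases x with
  | bot => simp
  | coe x =>
    cases y with
    | bot => simp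
    | coe y =>
      cases z with
      | bot => simp
      | coe z => simpa using incomparable_unique x y z

theorem b_sup_c (n : ℕ) : b.{u} n ⊔ c n = d n := by
  change join _ _ = _
  simp [join]

theorem b_himp_c (n : ℕ) : b.{u} n ⇨ c n = c n := by
  change imp _ _ = _
  simp [imp]

theorem c_himp_b (n : ℕ) : c.{u} n ⇨ b n = b n := by
  change imp _ _ = _
  simp [imp]

theorem b_himp_d_succ (n : ℕ) : b.{u} n ⇨ d (n + 1) = c n := by
  change imp _ _ = _
  simp [imp]

theorem b_le_d (n : ℕ) : b.{u} n ≤ d n := Or.inr (by simp [depth])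

theorem c_succ_le_b (n : ℕ) : c.{u} (n + 1) ≤ b n := Or.inr (by simp [depth])

theorem b_succ_le_b (n : ℕ) : b.{u} (n + 1) ≤ b n := Or.inr (by simp [depth])

/-! ### Homomorphisms agreeing on every `b i` -/

section Hom

variable {C : Type v} [GeneralizedHeytingAlgebra C]

/-- Over a common value at `b n`, closeness at `c (n + 1)` transfers to `d n`. -/
theorem himp_c_succ_le_himp_d {f g : BrouwerianHom Ladder.{u} C} (h : ∀ i, f (b i) = g (b i))
    (n : ℕ) : f (c (n + 1)) ⇨ g (c (n + 1)) ≤ f (d n) ⇨ g (d n) := by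
  -- This writes `d n` as `b n ⊔ (b n ⇨ (b (n + 1) ⊔ c (n + 1)))`, which is monotone in `c (n + 1)`;
  -- the claim is the internal form of that monotonicity.
  rw [← b_sup_c n, ← b_himp_d_succ n, ← b_sup_c (n + 1)]
  simp only [BrouwerianHom.apply_sup, BrouwerianHom.apply_himp, h]
  generalize g (b n) = x
  generalize g (b (n + 1)) = y
  generalize f (c (n + 1)) = p
  generalize g (c (n + 1)) = q
  have key : (p ⇨ q) ⊓ (y ⊔ p) ≤ y ⊔ q := by
    rw [inf_sup_left]
    exact sup_le_sup inf_le_right himp_inf_le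
  rw [le_himp_iff, inf_sup_left]
  refine sup_le_sup inf_le_right ?_
  rw [le_himp_iff, inf_assoc]
  exact (inf_le_inf_left _ himp_inf_le).trans key

/-- The identity decomposes `⊤` into five joinands, each below `f (d n) ⇨ g (d n)`. The first four
are images of `b (n + 1)` or `c (n + 1)`, hence lie below the common value at `b n`; the last is
handled by `himp_c_succ_le_himp_d`. -/
theorem hom_d_le {f g : BrouwerianHom Ladder.{u} C} (hC : UniqueIncomparable C)
    (h : ∀ i, f (b i) = g (b i)) (n : ℕ) : f (d n) ≤ g (d n) := by
  rw [← himp_eq_top_iff, eq_top_iff, ← hC (f (b (n + 1))) (f (c (n + 1))) (g (c (n + 1)))]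
  have hb : f (b n) ≤ f (d n) ⇨ g (d n) :=
    ((h n).trans_le (g.monotone (b_le_d n))).trans le_himp
  have hb' : g (b n) ≤ f (d n) ⇨ g (d n) := (h n).symm.trans_le hb
  refine sup_le (sup_le (sup_le (sup_le ?_ ?_) ?_) ?_) ?_
  · rw [← f.apply_himp, b_himp_c]
    exact (f.monotone (c_succ_le_b n)).trans hb
  · rw [← f.apply_himp, c_himp_b]
    exact (f.monotone (b_succ_le_b n)).trans hb
  · rw [h, ← g.apply_himp, b_himp_c]
    exact (g.monotone (c_succ_le_b n)).trans hb'
  · rw [h, ← g.apply_himp, c_himp_b]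
    exact (g.monotone (b_succ_le_b n)).trans hb'
  · exact inf_le_left.trans (himp_c_succ_le_himp_d h n)

theorem hom_eq {f g : BrouwerianHom Ladder.{u} C} (hC : UniqueIncomparable C)
    (h : ∀ i, f (b i) = g (b i)) (x : Ladder.{u}) : f x = g x := by
  have hd (n : ℕ) : f (d n) = g (d n) :=
    (hom_d_le hC h n).antisymm (hom_d_le hC (fun i => (h i).symm) n)
  cases x with
  | top => exact f.apply_top.trans g.apply_top.symm
  | d n => exact hd n
  | b n => exact h n
  -- `c n` is definable from `b n` and `d (n + 1)`, where agreement is already known.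
  | c n => rw [← b_himp_d_succ, f.apply_himp, g.apply_himp, h, hd]

end Hom

theorem B_isEpic : B.{u}.IsEpic (brouwerianVariety Ladder.{u}) := fun _ _ hC _ _ h =>
  BrouwerianHom.ext <| hom_eq (uniqueIncomparable.of_brouwerianVariety hC)
    fun i => h _ (Or.inl ⟨i, rfl⟩)

theorem Bbot_isEpic : Bbot.{u}.IsEpic (heytingVariety (WithBot Ladder.{u})) := by
  intro C _ hC f g h
  refine DFunLike.ext f g fun x => ?_
  cases x with
  | bot => rw [map_bot, map_bot]
  | coe x =>
    exact hom_eq (f := f.toBrouwerianHom.comp (WithBot.brouwerianCoe _))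
      (g := g.toBrouwerianHom.comp (WithBot.brouwerianCoe _))
      (uniqueIncomparable_withBot.of_heytingVariety hC)
      (fun i => h _ (Or.inr ⟨b i, Or.inl ⟨i, rfl⟩, rfl⟩)) x

theorem c_notMem_B (n : ℕ) : c.{u} n ∉ B.{u}.carrier := by
  rintro (⟨i, hi⟩ | h)
  · cases hi
  · cases (h : c n = top)

theorem B_ne_univ : B.{u}.carrier ≠ Set.univ :=
  (Set.ne_univ_iff_exists_notMem _).2 ⟨c 0, c_notMem_B 0⟩

theorem Bbot_ne_univ : Bbot.{u}.carrier ≠ Set.univ := by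
  refine (Set.ne_univ_iff_exists_notMem _).2 ⟨WithBot.some (c 0), ?_⟩
  rintro (h | ⟨x, hx, h⟩)
  · cases h
  · exact c_notMem_B 0 (WithBot.coe_injective h ▸ hx)

/-! ### Cardinality and subdirect irreducibility -/

instance : Infinite Ladder.{u} :=
  Infinite.of_injective d fun _ _ h => d.inj h

instance : Countable Ladder.{u} := by
  refine Function.Surjective.countable
    (f := fun p : Option (ℕ ⊕ ℕ ⊕ ℕ) => p.elim top (Sum.elim d (Sum.elim b c))) fun x => ?_
  cases x with
  | top => exact ⟨none, rfl⟩
  | d i => exact ⟨some (.inl i), rfl⟩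
  | b i => exact ⟨some (.inr (.inl i)), rfl⟩
  | c i => exact ⟨some (.inr (.inr i)), rfl⟩

theorem le_d_zero {x : Ladder.{u}} (h : x ≠ ⊤) : x ≤ d 0 := by
  cases x with
  | top => exact absurd rfl h
  | d i => rcases i with _ | i <;> simp [le_def, depth]
  | b i => simp [le_def, depth]
  | c i => simp [le_def, depth]

theorem d_zero_ne_top : d.{u} 0 ≠ ⊤ := fun h => by cases (h : d 0 = top)

end Ladder

/-- The congruence of the principal filter generated by `e`. -/
theorem isBrouwerianCongruence_ker_inf {A : Type u} [GeneralizedHeytingAlgebra A] (e : A) :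
    IsBrouwerianCongruence (Setoid.ker (· ⊓ e)) where
  inf {p q r s} h₁ h₂ := by
    simp only [Setoid.ker_def] at *
    rw [inf_inf_distrib_right, h₁, h₂, ← inf_inf_distrib_right]
  sup {p q r s} h₁ h₂ := by
    simp only [Setoid.ker_def] at *
    rw [inf_sup_right, h₁, h₂, ← inf_sup_right]
  himp {p q r s} h₁ h₂ := by
    simp only [Setoid.ker_def] at *
    have key {p q r s : A} (h₁ : p ⊓ e = q ⊓ e) (h₂ : r ⊓ e = s ⊓ e) :
        (p ⇨ r) ⊓ e ≤ (q ⇨ s) ⊓ e := by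
      refine le_inf (le_himp_iff.2 ?_) inf_le_right
      calc (p ⇨ r) ⊓ e ⊓ q = (p ⇨ r) ⊓ p ⊓ e := by rw [inf_assoc, inf_comm e, ← h₁, inf_assoc]
        _ ≤ r ⊓ e := inf_le_inf_right _ himp_inf_le
        _ ≤ s := h₂.trans_le inf_le_left
    exact (key h₁ h₂).antisymm (key h₁.symm h₂.symm)

/-- A Brouwerian algebra with a greatest element below `⊤` is subdirectly irreducible. -/
theorem isSubdirectlyIrreducible_of_coatom {A : Type u} [GeneralizedHeytingAlgebra A] {e : A}
    (he : e ≠ ⊤) (h : ∀ x : A, x ≠ ⊤ → x ≤ e) : IsSubdirectlyIrreducible A := by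
  refine ⟨_, isBrouwerianCongruence_ker_inf e, fun hbot => he ?_, fun φ hφ hne => ?_⟩
  · have : Setoid.ker (· ⊓ e) e ⊤ := by simp [Setoid.ker_def]
    rwa [hbot] at this
  -- The kernel of meeting with `e` is the congruence generated by `(e, ⊤)`, so it suffices that `φ`
  -- relates this pair.
  have hmem : φ e ⊤ := by
    by_contra hcon
    refine hne (Setoid.ext fun x y => ⟨fun hxy => ?_, fun hxy => hxy ▸ φ.refl x⟩)
    have le_of_rel {x y : A} (hxy : φ x y) : x ≤ y := by
      by_contra hle
      -- Since `x ≤ y` fails, `x ⇨ y` is not `⊤`, hence lies below `e`; joining this relation with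
      -- `e` then relates `e` to `⊤`.
      have h₁ : φ (x ⇨ y) ⊤ := by simpa using hφ.himp hxy (φ.refl y)
      have h₂ := hφ.sup h₁ (φ.refl e)
      rw [sup_eq_right.2 (h _ (mt himp_eq_top_iff.1 hle)), top_sup_eq] at h₂
      exact hcon h₂
    exact (le_of_rel hxy).antisymm (le_of_rel (φ.symm hxy))
  intro x y hxy
  have key (z : A) : φ (z ⊓ e) z := by simpa using hφ.inf (φ.refl z) hmem
  exact φ.trans (φ.symm (key x)) (φ.trans ((Setoid.ker_def.1 hxy : x ⊓ e = y ⊓ e) ▸ φ.refl _) (key y))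

theorem mainTheorem3 :
    (Infinite Ladder.{u} ∧ Countable Ladder.{u} ∧ IsSubdirectlyIrreducible Ladder.{u}) ∧
    (Ladder.B.{u}.carrier = Set.range Ladder.b.{u} ∪ {⊤} ∧
      Ladder.B.{u}.carrier ≠ Set.univ ∧
      Ladder.B.{u}.IsEpic (brouwerianVariety Ladder.{u}) ∧
      ¬ BrouwerianES (brouwerianVariety Ladder.{u})) ∧
    (Ladder.Bbot.{u}.carrier = insert ⊥ (WithBot.some '' Ladder.B.{u}.carrier) ∧
      Ladder.Bbot.{u}.carrier ≠ Set.univ ∧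
      Ladder.Bbot.{u}.IsEpic (heytingVariety (WithBot Ladder.{u})) ∧
      ¬ HeytingES (heytingVariety (WithBot Ladder.{u}))) := by
  exact ⟨⟨inferInstance, inferInstance,
      isSubdirectlyIrreducible_of_coatom Ladder.d_zero_ne_top fun _ => Ladder.le_d_zero⟩,
    ⟨rfl, Ladder.B_ne_univ, Ladder.B_isEpic,
      not_brouwerianES_of_isEpic _ Ladder.B_ne_univ Ladder.B_isEpic⟩,
    ⟨rfl, Ladder.Bbot_ne_univ, Ladder.Bbot_isEpic,
      not_heytingES_of_isEpic _ Ladder.Bbot_ne_univ Ladder.Bbot_isEpic⟩⟩
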